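/- **Setting.** Let $H_{2n+1}$ be the group of real $(n+2)\times(n+2)$ matrices $\begin{pmatrix}1&v^T&x\\0&\mathrm{Id}_n&w\\0&0&1\end{pmatrix}$ with $v,w\in\mathbb R^n$, $x\in\mathbb R$, a Lie group with global chart $(v,w,x)$, and let $\hat E_p,\hat F_p,\hat Z$ ($1\le p\le n$) be the basis of its Lie algebra $\mathfrak h_{2n+1}$ given by the coordinate vectors $\partial_{v_p},\partial_{w_p},\partial_x$ at the identity. Let $a,b\in\mathbb R_{>0}^n$, $c>0$. The vectors $Z=\hat Z/\sqrt c$, $E_p=\hat E_p/\sqrt{a_p}$, $F_p=\hat F_p/\sqrt{b_p}$ satisfy $$[E_p,F_q]=\delta_{pq}\sqrt{\tfrac{c}{a_pb_p}}\;Z,\qquad [E_p,Z]=[F_p,Z]=[E_p,E_q]=[F_p,F_q]=0,\tag{$*$}$$ and they are orthonormal for some left-invariant Riemannian metric on $H_{2n+1}$. More generally, let $g$ be a left-invariant Riemannian metric on $H_{2n+1}$ and $(Z,E_1,F_1,\dots,E_n,F_n)$ a $g$-orthonormal basis of $\mathfrak h_{2n+1}$ satisfying $(*)$. Let $\Sigma=\Lambda^\bullet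 L'$, where $L'$ is the complex vector space with basis $y_p=\frac1{\sqrt2}(E_p+iF_p)$, and let $x_p\lrcorner$ be the antiderivation of $\Sigma$ with $x_p\lrcorner y_q=\delta_{pq}$. The Clifford action of the basis on $\Sigma$ is $$Z\cdot\eta=i(\eta_{\rm even}-\eta_{\rm odd}),\quad E_p\cdot\eta=i(x_p\lrcorner\eta+y_p\wedge\eta),\quad F_p\cdot\eta=y_p\wedge\eta-x_p\lrcorner\eta .$$ Trivialise the spinor bundle of the invariant spin structure as $H_{2n+1}\times\Sigma$ by the left-invariant frame $(e_i)$ extending the basis, so that spinor fields are smooth maps $\psi:H_{2n+1}\to\Sigma$, invariant ones are the constant maps, and the spin connection is $\widetilde\nabla_X\psi=d\psi(X)+\frac12\sum_{i<j}g(\nabla_Xe_i,e_j)\,e_i\cdot e_j\cdot\psi$, with $\nabla$ the Levi-Civita connection of $g$. A spinor field $\psi$ is *generalised Killing* if there is a smooth $g$-symmetric endomorphism field $A$ of the tangent bundle with $\widetilde\nabla_X\psi=A(X)\cdot\psi$ for all $X$; the eigenvalues of $A$ are called the eigenvalues of $\psi$. **Theorem.** For all $n$, $a$, $b$, $c$,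 $g$ and bases as above, the Levi-Civita connection exists and the invariant spinor determined by $1\in\Sigma$ is a generalised Killing spinor. For every such $A$, the set of eigenvalues of $A$ at each point is $$\Big\{\lambda_p=\tfrac14\sqrt{\tfrac{c}{a_pb_p}}\;:\;1\le p\le n\Big\}\cup\Big\{\mu=-\sum_{q=1}^n\lambda_q\Big\}.$$ In particular, when $b_p=c=1$, $a_p=p^2$ and $g$ is a left-invariant metric for which $\hat Z/\sqrt c$, $\hat E_p/\sqrt{a_p}$, $\hat F_p/\sqrt{b_p}$ are orthonormal, there are exactly $n+1$ distinct eigenvalues. Hence for every $r\ge1$ there are an $n$ and a left-invariant metric on $H_{2n+1}$ carrying a non-zero invariant generalised Killing spinor with exactly $r$ distinct eigenvalues. -/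

import Mathlib

open scoped Manifold ContDiff

noncomputable section

/-! ## The Heisenberg group -/

/-- The model vector space `ℝⁿ × ℝⁿ × ℝ` of the Heisenberg group. -/
abbrev HeisModel (n : ℕ) : Type := (Fin n → ℝ) × (Fin n → ℝ) × ℝ

/-- The Heisenberg group `H_{2n+1}`: the element `(v, w, x)` stands for the matrix
`Heisenberg.toMatrix (v, w, x)`, with rows `(1, vᵀ, x)`, `(0, Id, w)`, `(0, 0, 1)`. The topology and
the smooth structure are those of the global chart `(v, w, x)`. -/
def Heisenberg (n : ℕ) : Type := HeisModel n

namespace Heisenberg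

variable {n : ℕ}

instance : TopologicalSpace (Heisenberg n) := inferInstanceAs (TopologicalSpace (HeisModel n))

instance : ChartedSpace (HeisModel n) (Heisenberg n) :=
  inferInstanceAs (ChartedSpace (HeisModel n) (HeisModel n))

instance (k : WithTop ℕ∞) : IsManifold 𝓘(ℝ, HeisModel n) k (Heisenberg n) :=
  inferInstanceAs (IsManifold 𝓘(ℝ, HeisModel n) k (HeisModel n))

/-- The point with coordinates `(v, w, x)`. -/
def mk (v w : Fin n → ℝ) (x : ℝ) : Heisenberg n := (v, w, x)

/-- The entry `v`. -/
def v (g : Heisenberg n) : Fin n → ℝ := g.1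
/-- The entry `w`. -/
def w (g : Heisenberg n) : Fin n → ℝ := g.2.1
/-- The entry `x`. -/
def x (g : Heisenberg n) : ℝ := g.2.2

@[ext] theorem ext {g h : Heisenberg n} (hv : g.v = h.v) (hw : g.w = h.w) (hx : g.x = h.x) :
    g = h := Prod.ext hv (Prod.ext hw hx)

instance : Mul (Heisenberg n) := ⟨fun g h => mk (g.v + h.v) (g.w + h.w) (g.x + h.x + g.v ⬝ᵥ h.w)⟩
instance : One (Heisenberg n) := ⟨mk 0 0 0⟩
instance : Inv (Heisenberg n) := ⟨fun g => mk (-g.v) (-g.w) (-g.x + g.v ⬝ᵥ g.w)⟩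

@[simp] theorem mul_v (g h : Heisenberg n) : (g * h).v = g.v + h.v := rfl
@[simp] theorem mul_w (g h : Heisenberg n) : (g * h).w = g.w + h.w := rfl
@[simp] theorem mul_x (g h : Heisenberg n) : (g * h).x = g.x + h.x + g.v ⬝ᵥ h.w := rfl
@[simp] theorem one_v : (1 : Heisenberg n).v = 0 := rfl
@[simp] theorem one_w : (1 : Heisenberg n).w = 0 := rfl
@[simp] theorem one_x : (1 : Heisenberg n).x = 0 := rfl
@[simp] theorem inv_v (g : Heisenberg n) : (g⁻¹).v = -g.v := rfl
@[simp] theorem inv_w (g : Heisenberg n) : (g⁻¹).w = -g.w := rfl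
@[simp] theorem inv_x (g : Heisenberg n) : (g⁻¹).x = -g.x + g.v ⬝ᵥ g.w := rfl

instance : Group (Heisenberg n) :=
  Group.ofLeftAxioms
    (fun a b c => by
      ext1
      · simp [add_assoc]
      · simp [add_assoc]
      · simp only [mul_x, mul_v, mul_w, add_dotProduct, dotProduct_add]; ring)
    (fun a => by ext1 <;> simp)
    (fun a => by ext1 <;> simp)

/-- The `(n+2) × (n+2)` matrix with rows `(1, vᵀ, x)`, `(0, Id, w)`, `(0, 0, 1)`. -/
def toMatrix (g : Heisenberg n) : Matrix (Unit ⊕ Fin n ⊕ Unit) (Unit ⊕ Fin n ⊕ Unit) ℝ :=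
  Matrix.fromBlocks 1
    (Matrix.fromCols (Matrix.of fun _ j => g.v j) (Matrix.of fun _ _ => g.x)) 0
    (Matrix.fromBlocks 1 (Matrix.of fun i _ => g.w i) 0 1)

/-- The group law is matrix multiplication. -/
theorem toMatrix_mul (g h : Heisenberg n) : (g * h).toMatrix = g.toMatrix * h.toMatrix := by
  ext i j
  rcases i with i | i | i <;> rcases j with j | j | j <;>
    simp [toMatrix, Matrix.mul_apply, Matrix.one_apply, dotProduct, add_comm, add_left_comm,
      add_assoc]

theorem toMatrix_injective : Function.Injective (toMatrix (n := n)) := by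
  intro g h H
  ext i
  · simpa [toMatrix] using congrFun (congrFun H (Sum.inl ())) (Sum.inr (Sum.inl i))
  · simpa [toMatrix] using congrFun (congrFun H (Sum.inr (Sum.inl i))) (Sum.inr (Sum.inr ()))
  · simpa [toMatrix] using congrFun (congrFun H (Sum.inl ())) (Sum.inr (Sum.inr ()))

instance : LieGroup 𝓘(ℝ, HeisModel n) ∞ (Heisenberg n) where
  contMDiff_mul := by
    have h : ContDiff ℝ ∞ (fun p : HeisModel n × HeisModel n =>
        ((p.1.1 + p.2.1, p.1.2.1 + p.2.2.1,
          p.1.2.2 + p.2.2.2 + ∑ i, p.1.1 i * p.2.2.1 i) : HeisModel n)) := by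
      fun_prop
    have h' := h.contMDiff
    rw [modelWithCornersSelf_prod, ← chartedSpaceSelf_prod] at h'
    exact h'
  contMDiff_inv := by
    have h : ContDiff ℝ ∞ (fun p : HeisModel n =>
        ((-p.1, -p.2.1, -p.2.2 + ∑ i, p.1 i * p.2.1 i) : HeisModel n)) := by
      fun_prop
    exact h.contMDiff

end Heisenberg

/-- The Lie algebra `𝔥_{2n+1}` of `H_{2n+1}`: the tangent space at the identity, with the bracket of
left-invariant vector fields. -/
abbrev HeisAlg (n : ℕ) : Type := GroupLieAlgebra 𝓘(ℝ, HeisModel n) (Heisenberg n)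

/-- Indices of a basis `(Z, E_1, F_1, …, E_n, F_n)`. -/
abbrev HeisIndex (n : ℕ) : Type := Unit ⊕ (Fin n ⊕ Fin n)

namespace HeisIndex

variable {n : ℕ}

/-- The index of `Z`. -/
abbrev Z : HeisIndex n := Sum.inl ()
/-- The index of `E_p`. -/
abbrev E (p : Fin n) : HeisIndex n := Sum.inr (Sum.inl p)
/-- The index of `F_p`. -/
abbrev F (p : Fin n) : HeisIndex n := Sum.inr (Sum.inr p)

end HeisIndex

/-- The rescaled standard basis `Ẑ / √c`, `Ê_p / √a_p`, `F̂_p / √b_p` of `𝔥_{2n+1}`, where `Ẑ`, `Ê_p`,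
`F̂_p` are the tangent vectors at the identity of the coordinates `x`, `v_p`, `w_p`. -/
def heisBasis {n : ℕ} (a b : Fin n → ℝ) (c : ℝ) : HeisIndex n → HeisAlg n
  | Sum.inl _ => ((0, 0, (√c)⁻¹) : HeisModel n)
  | Sum.inr (Sum.inl p) => ((Pi.single p (√(a p))⁻¹, 0, 0) : HeisModel n)
  | Sum.inr (Sum.inr p) => ((0, Pi.single p (√(b p))⁻¹, 0) : HeisModel n)

/-- The Lie bracket relations of `Z = Ẑ / √c`, `E_p = Ê_p / √a_p`, `F_p = F̂_p / √b_p`. -/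
structure HasHeisRelations {n : ℕ} (a b : Fin n → ℝ) (c : ℝ) (u : HeisIndex n → HeisAlg n) :
    Prop where
  lie_E_F : ∀ p q, ⁅u (.E p), u (.F q)⁆ = if p = q then √(c / (a p * b p)) • u .Z else 0
  lie_E_Z : ∀ p, ⁅u (.E p), u .Z⁆ = 0
  lie_F_Z : ∀ p, ⁅u (.F p), u .Z⁆ = 0
  lie_E_E : ∀ p q, ⁅u (.E p), u (.E q)⁆ = 0
  lie_F_F : ∀ p q, ⁅u (.F p), u (.F q)⁆ = 0

/-! ## Riemannian metrics and spinors on manifolds with a global orthonormal frame -/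

section General

variable {V : Type*} [NormedAddCommGroup V] [NormedSpace ℝ V] {H : Type*} [TopologicalSpace H]
  {I : ModelWithCorners ℝ V H} {M : Type*} [TopologicalSpace M] [ChartedSpace H M]
  [IsManifold I ∞ M]

variable (I M) in
/-- Smooth Riemannian metrics on `M`. -/
abbrev RiemMetric : Type _ :=
  Bundle.ContMDiffRiemannianMetric I ∞ V (fun x : M => TangentSpace I x)

/-- The metric `g` on the Lie group `M` is left-invariant. -/
def IsLeftInvariant [Group M] (g : RiemMetric I M) : Prop :=
  ∀ (x y : M) (v w : TangentSpace I y),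
    g.inner (x * y) (mfderiv I I (x * ·) y v) (mfderiv I I (x * ·) y w) = g.inner y v w

/-- `∇` is the Levi-Civita connection of `g`: it is torsion-free, and it is metric, that is
`X (g(σ, τ)) = g(∇_X σ, τ) + g(σ, ∇_X τ)`. -/
def IsLeviCivita [FiniteDimensional ℝ V] (g : RiemMetric I M)
    (nabla : CovariantDerivative I V (fun x : M => TangentSpace I x)) : Prop :=
  haveI : CompleteSpace V := FiniteDimensional.complete ℝ V
  nabla.torsion = 0 ∧
  ∀ (σ τ : ∀ x : M, TangentSpace I x) (x : M) (X : TangentSpace I x),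
    MDifferentiableAt I (I.prod 𝓘(ℝ, V)) (fun y => (⟨y, σ y⟩ : TangentBundle I M)) x →
    MDifferentiableAt I (I.prod 𝓘(ℝ, V)) (fun y => (⟨y, τ y⟩ : TangentBundle I M)) x →
    mvfderiv I (fun y => g.inner y (σ y) (τ y)) x X =
      g.inner x (nabla σ x X) (τ x) + g.inner x (σ x) (nabla τ x X)

variable {ι : Type*} [Fintype ι] {S : Type*} [NormedAddCommGroup S] [NormedSpace ℂ S]

/-- A global `g`-orthonormal frame `e` trivialises the orthonormal frame bundle, hence determines a
(trivial) spin structure, with spinor bundle `M × S` if the operators `γ i` are the Clifford action of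
the basis vectors `e_i` on the spin module `S`. This is Clifford multiplication of the spinor `s` at `x`
by the tangent vector `X = ∑ i, g(X, e_i) e_i`. -/
def cliffordMul (g : RiemMetric I M) (e : ι → ∀ x : M, TangentSpace I x) (γ : ι → S →ₗ[ℂ] S)
    (x : M) (X : TangentSpace I x) (s : S) : S :=
  ∑ i, (g.inner x X (e i x) : ℂ) • γ i s

/-- The lift to spinors of the skew endomorphism `A` of the span of the orthonormal `e_i`, given by its
coefficients `A i j = ⟨A e_i, e_j⟩`. It is the isomorphism `𝔰𝔬(m) ≅ 𝔰𝔭𝔦𝔫(m)`,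
`e_i ∧ e_j ↦ (1/2) e_i · e_j`, where `e_i ∧ e_j` maps `e_i` to `e_j` and `e_j` to `- e_i`: indeed `A` is
the sum of the `A i j • (e_i ∧ e_j)` over the unordered pairs, that is half the sum over all `(i, j)`. -/
def spinLift (γ : ι → S →ₗ[ℂ] S) (A : ι → ι → ℝ) (s : S) : S :=
  (1 / 2 : ℂ) • ∑ i, ∑ j, (A i j : ℂ) • ((1 / 2 : ℂ) • γ i (γ j s))

/-- The spin connection `(∇̃_X ψ)(x)` on spinor fields `ψ : M → S` in the trivialisation given by `e`:
the derivative of `ψ` plus the lift of the connection form `g(∇_X e_i, e_j)` of `∇`. -/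
def spinConnection (g : RiemMetric I M)
    (nabla : CovariantDerivative I V (fun x : M => TangentSpace I x))
    (e : ι → ∀ x : M, TangentSpace I x) (γ : ι → S →ₗ[ℂ] S) (ψ : M → S)
    (x : M) (X : TangentSpace I x) : S :=
  mvfderiv I ψ x X + spinLift γ (fun i j => g.inner x (nabla (e i) x X) (e j x)) (ψ x)

/-- The smooth spinor field `ψ` is generalised Killing with endomorphism `A`: `A` is a smooth
`g`-symmetric endomorphism field, and `∇̃_X ψ = A(X) · ψ` for all `X`. -/
structure IsGenKillingWith (g : RiemMetric I M)
    (nabla : CovariantDerivative I V (fun x : M => TangentSpace I x))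
    (e : ι → ∀ x : M, TangentSpace I x) (γ : ι → S →ₗ[ℂ] S) (ψ : M → S)
    (A : ∀ x : M, TangentSpace I x →L[ℝ] TangentSpace I x) : Prop where
  smooth_spinor : ContMDiff I 𝓘(ℝ, S) ∞ ψ
  smooth_endo : ContMDiff I (I.prod 𝓘(ℝ, V →L[ℝ] V)) ∞
    (fun x => Bundle.TotalSpace.mk' (V →L[ℝ] V)
      (E := fun x : M => TangentSpace I x →L[ℝ] TangentSpace I x) x (A x))
  symm : ∀ (x : M) (X Y : TangentSpace I x), g.inner x (A x X) Y = g.inner x X (A x Y)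
  eq : ∀ (x : M) (X : TangentSpace I x),
    spinConnection g nabla e γ ψ x X = cliffordMul g e γ x (A x X) (ψ x)

/-- The spinor field `ψ` is a generalised Killing spinor. -/
def IsGenKilling (g : RiemMetric I M)
    (nabla : CovariantDerivative I V (fun x : M => TangentSpace I x))
    (e : ι → ∀ x : M, TangentSpace I x) (γ : ι → S →ₗ[ℂ] S) (ψ : M → S) : Prop :=
  ∃ A, IsGenKillingWith g nabla e γ ψ A

/-- The set of eigenvalues at `x` of an endomorphism field. -/
def eigenvaluesAt (A : ∀ x : M, TangentSpace I x →L[ℝ] TangentSpace I x) (x : M) : Set ℝ :=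
  {r | Module.End.HasEigenvalue ((A x : TangentSpace I x →ₗ[ℝ] TangentSpace I x)) r}

end General

/-! ## The spin module -/

section Spinor

variable {n : ℕ}

instance : Module.Finite ℂ (ExteriorAlgebra ℂ (Fin n → ℂ)) := by
  classical
  have h1 : (⨆ k, ⋀[ℂ]^k (Fin n → ℂ)) = ⊤ :=
    (DirectSum.Decomposition.isInternal
      (fun k => ⋀[ℂ]^k (Fin n → ℂ))).submodule_iSup_eq_top
  have h2 : (⨆ k, ⋀[ℂ]^k (Fin n → ℂ)) ≤ ⨆ k ∈ Finset.range (n + 1), ⋀[ℂ]^k (Fin n → ℂ) := by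
    refine iSup_le fun k => ?_
    by_cases hk : k < n + 1
    · exact le_iSup₂_of_le k (Finset.mem_range.2 hk) le_rfl
    · have : Module.finrank ℂ (⋀[ℂ]^k (Fin n → ℂ)) = 0 := by
        rw [exteriorPower.finrank_eq, Module.finrank_fin_fun]
        exact Nat.choose_eq_zero_of_lt (by omega)
      rw [Submodule.finrank_eq_zero.1 this]
      exact bot_le
  refine ⟨?_⟩
  rw [← top_le_iff.1 (h1.symm.le.trans h2)]
  exact Submodule.fg_biSup _ _ fun k _ => Module.Finite.iff_fg.1 inferInstance

/-- The spin module `Σ = Λ• L'`, the exterior algebra on the complex vector space `L'` with basis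
`y_1, …, y_n`, where `y_p = (E_p + i F_p) / √2` is the `p`-th standard vector of `ℂⁿ`. -/
def Spinor (n : ℕ) : Type := ExteriorAlgebra ℂ (Fin n → ℂ)

instance : AddCommGroup (Spinor n) := inferInstanceAs (AddCommGroup (ExteriorAlgebra ℂ (Fin n → ℂ)))
instance : Module ℂ (Spinor n) := inferInstanceAs (Module ℂ (ExteriorAlgebra ℂ (Fin n → ℂ)))
instance : One (Spinor n) := inferInstanceAs (One (ExteriorAlgebra ℂ (Fin n → ℂ)))
instance : Module.Finite ℂ (Spinor n) :=
  inferInstanceAs (Module.Finite ℂ (ExteriorAlgebra ℂ (Fin n → ℂ)))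

/-- An auxiliary norm on the finite-dimensional space `Σ` (the supremum norm in some basis). It only
serves to speak of derivatives, which do not depend on the choice of a norm. -/
instance : NormedAddCommGroup (Spinor n) :=
  NormedAddCommGroup.induced (Spinor n) _ (Module.finBasis ℂ (Spinor n)).equivFun
    (Module.finBasis ℂ (Spinor n)).equivFun.injective

instance : NormedSpace ℂ (Spinor n) :=
  NormedSpace.induced ℂ (Spinor n) _ (Module.finBasis ℂ (Spinor n)).equivFun

/-- The operator `y_p ∧ ·`. -/
def wedgeY (p : Fin n) : Spinor n →ₗ[ℂ] Spinor n :=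
  LinearMap.mulLeft ℂ (A := ExteriorAlgebra ℂ (Fin n → ℂ)) (ExteriorAlgebra.ι ℂ (Pi.single p 1))

/-- The operator `x_p ⌟ ·`: the antiderivation with `x_p ⌟ y_q = δ_{pq}`, the value at
`(x_p, y_q)` of the complex bilinear extension of the inner product, for `x_p = (E_p - i F_p) / √2`. -/
def contractX (p : Fin n) : Spinor n →ₗ[ℂ] Spinor n :=
  CliffordAlgebra.contractLeft (Q := (0 : QuadraticForm ℂ (Fin n → ℂ)))
    (LinearMap.proj p : (Fin n → ℂ) →ₗ[ℂ] ℂ)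

/-- The parity operator `η ↦ η_even - η_odd`. -/
def parity : Spinor n →ₗ[ℂ] Spinor n :=
  (CliffordAlgebra.involute (Q := (0 : QuadraticForm ℂ (Fin n → ℂ)))).toLinearMap

/-- The Clifford action of an orthonormal basis `(Z, E_1, F_1, …, E_n, F_n)` on `Σ`:
`Z · η = i (η_even - η_odd)`, `E_p · η = i (x_p ⌟ η + y_p ∧ η)`, `F_p · η = y_p ∧ η - x_p ⌟ η`. -/
def heisGamma : HeisIndex n → Spinor n →ₗ[ℂ] Spinor n
  | Sum.inl _ => Complex.I • parity
  | Sum.inr (Sum.inl p) => Complex.I • (contractX p + wedgeY p)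
  | Sum.inr (Sum.inr p) => wedgeY p - contractX p

theorem wedgeY_wedgeY (p q : Fin n) (η : Spinor n) :
    wedgeY p (wedgeY q η) = -wedgeY q (wedgeY p η) := by
  rw [eq_neg_iff_add_eq_zero]
  have h := ExteriorAlgebra.ι_add_mul_swap (R := ℂ) (M := Fin n → ℂ) (Pi.single p 1) (Pi.single q 1)
  have h' (z : ExteriorAlgebra ℂ (Fin n → ℂ)) :
      ExteriorAlgebra.ι ℂ (Pi.single p 1) * (ExteriorAlgebra.ι ℂ (Pi.single q 1) * z) +
        ExteriorAlgebra.ι ℂ (Pi.single q 1) * (ExteriorAlgebra.ι ℂ (Pi.single p 1) * z) = 0 := by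
    rw [← mul_assoc, ← mul_assoc, ← add_mul, h, zero_mul]
  exact h' η

theorem contractX_contractX (p q : Fin n) (η : Spinor n) :
    contractX p (contractX q η) = -contractX q (contractX p η) :=
  CliffordAlgebra.contractLeft_comm (Q := (0 : QuadraticForm ℂ (Fin n → ℂ)))
    (d := (LinearMap.proj p : (Fin n → ℂ) →ₗ[ℂ] ℂ))
    (d' := (LinearMap.proj q : (Fin n → ℂ) →ₗ[ℂ] ℂ)) η

theorem contractX_wedgeY (p q : Fin n) (η : Spinor n) :
    contractX p (wedgeY q η) = (if p = q then (1 : ℂ) else 0) • η - wedgeY q (contractX p η) := by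
  have h := CliffordAlgebra.contractLeft_ι_mul (Q := (0 : QuadraticForm ℂ (Fin n → ℂ)))
    (d := (LinearMap.proj p : (Fin n → ℂ) →ₗ[ℂ] ℂ)) (Pi.single q 1) η
  rw [show (LinearMap.proj p : (Fin n → ℂ) →ₗ[ℂ] ℂ) (Pi.single q 1) = if p = q then (1 : ℂ) else 0
    from Pi.single_apply q 1 p] at h
  exact h

theorem parity_parity (η : Spinor n) : parity (parity η) = η :=
  CliffordAlgebra.involute_involute (Q := (0 : QuadraticForm ℂ (Fin n → ℂ))) η

theorem parity_wedgeY (p : Fin n) (η : Spinor n) : parity (wedgeY p η) = -wedgeY p (parity η) := by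
  have h := map_mul (CliffordAlgebra.involute (Q := (0 : QuadraticForm ℂ (Fin n → ℂ))))
    (CliffordAlgebra.ι _ (Pi.single p 1)) η
  rw [CliffordAlgebra.involute_ι, neg_mul] at h
  exact h

theorem parity_contractX (p : Fin n) (η : Spinor n) :
    parity (contractX p η) = -contractX p (parity η) := by
  let Q : QuadraticForm ℂ (Fin n → ℂ) := 0
  let d : Module.Dual ℂ (Fin n → ℂ) := LinearMap.proj p
  suffices h : ∀ z : CliffordAlgebra Q, CliffordAlgebra.involute (CliffordAlgebra.contractLeft d z) =
      -CliffordAlgebra.contractLeft d (CliffordAlgebra.involute z) from h η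
  intro z
  induction z using CliffordAlgebra.left_induction with
  | algebraMap r => simp
  | add x y hx hy => simp only [map_add, hx, hy, neg_add]
  | ι_mul x m hx =>
    simp only [map_mul, CliffordAlgebra.contractLeft_ι_mul, map_sub, map_smul,
      CliffordAlgebra.involute_ι, neg_mul, map_neg, hx, mul_neg, neg_neg]

/-- The operators `heisGamma i` satisfy the Clifford relations `e_i e_j + e_j e_i = - 2 δ_{ij}`. -/
theorem heisGamma_clifford (i j : HeisIndex n) (η : Spinor n) :
    heisGamma i (heisGamma j η) + heisGamma j (heisGamma i η) = if i = j then (-2 : ℂ) • η else 0 := by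
  have hI (z : Spinor n) : Complex.I • Complex.I • z = -z := by
    rw [smul_smul, Complex.I_mul_I, neg_one_smul]
  rcases i with i | p | p <;> rcases j with j | q | q <;>
    simp only [heisGamma, LinearMap.smul_apply, LinearMap.add_apply, LinearMap.sub_apply, map_smul,
      map_add, map_sub, hI, parity_parity, parity_wedgeY, parity_contractX, contractX_wedgeY,
      reduceCtorEq, if_false, Sum.inl.injEq, Sum.inr.injEq, smul_add, smul_sub]
  · simp; module
  · module
  · module
  · module
  · rw [wedgeY_wedgeY p q, contractX_contractX p q]
    by_cases h : p = q
    · simp [h]; module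
    · simp [h, Ne.symm h]; module
  · rw [wedgeY_wedgeY p q, contractX_contractX p q]
    by_cases h : p = q
    · simp [h]; module
    · simp [h, Ne.symm h]; module
  · module
  · rw [wedgeY_wedgeY p q, contractX_contractX p q]
    by_cases h : p = q
    · simp [h]; module
    · simp [h, Ne.symm h]; module
  · rw [wedgeY_wedgeY p q, contractX_contractX p q]
    by_cases h : p = q
    · simp [h]; module
    · simp [h, Ne.symm h]; module

/-- The invariant spinor field on `H_{2n+1}` determined by `s ∈ Σ`: the constant map `s`. -/
def invariantSpinor (s : Spinor n) : Heisenberg n → Spinor n := fun _ => s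

/-- The left-invariant frame determined by vectors `u i` of the Lie algebra. -/
def leftInvFrame (u : HeisIndex n → HeisAlg n) (i : HeisIndex n) (x : Heisenberg n) :
    TangentSpace 𝓘(ℝ, HeisModel n) x :=
  mulInvariantVectorField (u i) x

/-- `g` is a left-invariant metric on `H_{2n+1}` for which the basis `u` of `𝔥_{2n+1}` is orthonormal. -/
def IsLeftInvariantWith (g : RiemMetric 𝓘(ℝ, HeisModel n) (Heisenberg n))
    (u : HeisIndex n → HeisAlg n) : Prop :=
  IsLeftInvariant g ∧ ∀ i j, g.inner 1 (u i) (u j) = if i = j then 1 else 0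

/-- Connections on the tangent bundle of `H_{2n+1}`. -/
abbrev HeisConnection (n : ℕ) : Type _ :=
  CovariantDerivative 𝓘(ℝ, HeisModel n) (HeisModel n)
    (fun x : Heisenberg n => TangentSpace 𝓘(ℝ, HeisModel n) x)

/-- Endomorphism fields of the tangent bundle of `H_{2n+1}`. -/
abbrev HeisEndo (n : ℕ) : Type _ :=
  ∀ x : Heisenberg n, TangentSpace 𝓘(ℝ, HeisModel n) x →L[ℝ] TangentSpace 𝓘(ℝ, HeisModel n) x

/-- `λ_p = (1/4) √(c / (a_p b_p))`. -/
def heisLambda (a b : Fin n → ℝ) (c : ℝ) (p : Fin n) : ℝ := 1 / 4 * √(c / (a p * b p))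

end Spinor

end

/-! A left-invariant orthonormal frame has constant structure functions, so everything reduces to
algebra on the Lie algebra and on `Σ`. If constants `Γ i j k`, antisymmetric in `j, k`, satisfy that
`Γ i j k - Γ j i k` are the structure constants, they define a Levi-Civita connection
(`isLeviCivita_connection`), and every Levi-Civita connection has these coefficients
(`inner_of_isLeviCivita`). A constant spinor `s` is then generalised Killing with a diagonal `A` as
soon as the spin lift of each `Γ i` sends `s` to `κ i • e_i · s`.

For the Heisenberg relations this is checked on `s = 1` (`spinLift_heisCoeff`). Contractions kill
`1`, so `Z · 1 = i`, `E_p · 1 = i y_p`, `F_p · 1 = y_p`. Hence `λ_p F_p · Z · 1 = λ_p E_p · 1`,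
`-λ_p E_p · Z · 1 = λ_p F_p · 1`, and `-∑ λ_p E_p · F_p · 1 = -(∑ λ_p) Z · 1`: each plane
contributes one term to the `Z` direction, whence `μ`.

No other `A` is possible, because the spinors `e_i · 1` are linearly independent over `ℝ`
(`heisGamma_one_independent`). For `a_p = p²` the `λ_p` are positive and distinct while `μ ≤ 0`,
which gives `n + 1` eigenvalues. -/

noncomputable section

/-! ## The Levi-Civita connection in an orthonormal frame -/

section OrthonormalFrame

variable {V : Type*} [NormedAddCommGroup V] [NormedSpace ℝ V] {H : Type*} [TopologicalSpace H]
  {I : ModelWithCorners ℝ V H} {M : Type*} [TopologicalSpace M] [ChartedSpace H M]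

/-- The two conclusions are proved together because the sum rule in the induction step needs the
partial sum to be differentiable. -/
theorem mdifferentiableAt_sum_and_mvfderiv_sum {κ : Type*} (s : Finset κ) {f : κ → M → ℝ} {x : M}
    (hf : ∀ k ∈ s, MDifferentiableAt I 𝓘(ℝ) (f k) x) :
    MDifferentiableAt I 𝓘(ℝ) (∑ k ∈ s, f k) x ∧
      mvfderiv I (∑ k ∈ s, f k) x = ∑ k ∈ s, mvfderiv I (f k) x := by
  classical
  induction s using Finset.induction_on with
  | empty => exact ⟨mdifferentiableAt_const, by simp⟩
  | insert a s ha ih =>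
    obtain ⟨h1, h2⟩ := ih fun k hk => hf k (Finset.mem_insert_of_mem hk)
    have h3 := hf a (Finset.mem_insert_self a s)
    rw [Finset.sum_insert ha, Finset.sum_insert ha, mvfderiv_add h3 h1, h2]
    exact ⟨h3.add h1, rfl⟩

variable [IsManifold I ∞ M] {ι : Type*} [Fintype ι] [DecidableEq ι]

/-- `e` is a global differentiable `g`-orthonormal frame. -/
structure IsOrthonormalFrame (g : RiemMetric I M) (e : ι → ∀ x : M, TangentSpace I x) : Prop where
  card_eq : Fintype.card ι = Module.finrank ℝ V
  mdifferentiable : ∀ i (x : M), MDifferentiableAt I (I.prod 𝓘(ℝ, V))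
    (fun y => (⟨y, e i y⟩ : TangentBundle I M)) x
  inner_eq : ∀ (x : M) i j, g.inner x (e i x) (e j x) = if i = j then 1 else 0

theorem RiemMetric.mdifferentiableAt_inner (g : RiemMetric I M) {σ τ : ∀ x : M, TangentSpace I x}
    {x : M}
    (hσ : MDifferentiableAt I (I.prod 𝓘(ℝ, V)) (fun y => (⟨y, σ y⟩ : TangentBundle I M)) x)
    (hτ : MDifferentiableAt I (I.prod 𝓘(ℝ, V)) (fun y => (⟨y, τ y⟩ : TangentBundle I M)) x) :
    MDifferentiableAt I 𝓘(ℝ) (fun y => g.inner y (σ y) (τ y)) x := by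
  have h := (g.contMDiff.mdifferentiableAt (x := x) (by simp))
  have h2 := MDifferentiableAt.clm_bundle_apply₂ (E₃ := Bundle.Trivial M ℝ)
    (F₁ := V) (F₂ := V) (F₃ := ℝ) h hσ hτ
  rw [mdifferentiableAt_section] at h2
  exact h2

namespace IsOrthonormalFrame

variable {g : RiemMetric I M} {e : ι → ∀ x : M, TangentSpace I x}

theorem linearIndependent (h : IsOrthonormalFrame g e) (x : M) :
    LinearIndependent ℝ (fun i => e i x) := by
  rw [Fintype.linearIndependent_iff]
  intro a ha j
  have := congrArg (fun X => g.inner x X (e j x)) ha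
  simpa [h.inner_eq] using this

theorem mvfderiv_inner_frame (h : IsOrthonormalFrame g e) (i j : ι) (x : M) :
    mvfderiv I (fun y => g.inner y (e i y) (e j y)) x = 0 := by
  simp only [h.inner_eq]
  exact mvfderiv_const _

variable [FiniteDimensional ℝ V]

/-- The basis of the tangent space at `x` given by an orthonormal frame. -/
def basis (h : IsOrthonormalFrame g e) (x : M) : Module.Basis ι ℝ (TangentSpace I x) :=
  haveI : FiniteDimensional ℝ (TangentSpace I x) := inferInstanceAs (FiniteDimensional ℝ V)
  Module.Basis.mk (h.linearIndependent x)
    ((h.linearIndependent x).span_eq_top_of_card_eq_finrank' h.card_eq).ge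

@[simp] theorem basis_apply (h : IsOrthonormalFrame g e) (x : M) (i : ι) :
    h.basis x i = e i x := by simp [basis]

theorem sum_inner_smul (h : IsOrthonormalFrame g e) (x : M) (X : TangentSpace I x) :
    ∑ i, g.inner x X (e i x) • e i x = X := by
  have key : (∑ i, (g.inner x (e i x)).toLinearMap.smulRight (e i x) :
      TangentSpace I x →ₗ[ℝ] TangentSpace I x) = LinearMap.id := by
    refine (h.basis x).ext fun j => ?_
    simp [h.inner_eq]
  simpa [g.symm x X] using congrArg (fun f => f X) key

theorem ext_inner (h : IsOrthonormalFrame g e) {x : M} {X Y : TangentSpace I x}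
    (H : ∀ i, g.inner x X (e i x) = g.inner x Y (e i x)) : X = Y := by
  rw [← h.sum_inner_smul x X, ← h.sum_inner_smul x Y]
  simp [H]

theorem inner_eq_sum (h : IsOrthonormalFrame g e) (x : M) (X Y : TangentSpace I x) :
    g.inner x X Y = ∑ i, g.inner x X (e i x) * g.inner x Y (e i x) := by
  conv_lhs => rw [← h.sum_inner_smul x Y]
  simp [mul_comm]

/-- The covariant derivative for which `∇_{e_i} e_j = ∑ k, Γ i j k e_k`. -/
def connection (h : IsOrthonormalFrame g e) (Γ : ι → ι → ι → ℝ) :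
    CovariantDerivative I V (fun x : M => TangentSpace I x) where
  toFun σ x := ∑ k, (mvfderiv I (fun y => g.inner y (σ y) (e k y)) x +
    ∑ i, ∑ j, (Γ i j k * g.inner x (σ x) (e j x)) • g.inner x (e i x)).smulRight (e k x)
  isCovariantDerivativeOnUniv :=
    { add := by
        intro σ τ x hσ hτ _
        rw [← Finset.sum_add_distrib]
        refine Finset.sum_congr rfl fun k _ => ?_
        have h1 : (fun y => g.inner y ((σ + τ) y) (e k y)) =
            (fun y => g.inner y (σ y) (e k y)) + fun y => g.inner y (τ y) (e k y) := by
          ext y; simp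
        rw [h1, mvfderiv_add (g.mdifferentiableAt_inner hσ (h.mdifferentiable k x))
          (g.mdifferentiableAt_inner hτ (h.mdifferentiable k x))]
        ext X
        simp only [ContinuousLinearMap.smulRight_apply, add_apply,
          Pi.add_apply, map_add, mul_add, add_smul, Finset.sum_add_distrib]
        module
      leibniz := by
        intro σ f x hσ hf _
        have h1 k : (fun y => g.inner y ((f • σ) y) (e k y)) =
            f • (fun y => g.inner y (σ y) (e k y)) := by
          ext y; simp
        ext X
        -- The extra Leibniz term is expanded in the frame, so that the identity can be compared
        -- coefficient by coefficient.
        have hX : (mvfderiv I f x X) • σ x =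
            ∑ k, (mvfderiv I f x X * g.inner x (σ x) (e k x)) • e k x := by
          conv_lhs => rw [← h.sum_inner_smul x (σ x)]
          simp only [Finset.smul_sum, smul_smul]
        simp only [h1, add_apply, smul_apply,
          ContinuousLinearMap.smulRight_apply, hX, sum_apply, Finset.smul_sum]
        rw [← Finset.sum_add_distrib]
        refine Finset.sum_congr rfl fun k _ => ?_
        rw [mvfderiv_smul hf (g.mdifferentiableAt_inner hσ (h.mdifferentiable k x))]
        simp only [Pi.smul_apply', map_smul, add_apply,
          smul_apply, ContinuousLinearMap.smulRight_apply, smul_eq_mul]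
        rw [smul_smul, ← add_smul]
        congr 1
        simp only [mul_add, Finset.mul_sum]
        rw [add_right_comm]
        congr 1
        refine congrArg₂ (· + ·) rfl
          (Finset.sum_congr rfl fun i _ => Finset.sum_congr rfl fun j _ => ?_)
        ring }

theorem inner_connection (h : IsOrthonormalFrame g e) (Γ : ι → ι → ι → ℝ)
    (σ : ∀ x : M, TangentSpace I x) (x : M) (X : TangentSpace I x) (k : ι) :
    g.inner x (h.connection Γ σ x X) (e k x) =
      mvfderiv I (fun y => g.inner y (σ y) (e k y)) x X +
        ∑ i, ∑ j, Γ i j k * g.inner x (σ x) (e j x) * g.inner x X (e i x) := by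
  simp [connection, h.inner_eq, g.symm x X]

/-- The structure functions of the frame are the constants `Γ i j k - Γ j i k`, where `Γ` is
antisymmetric in the last two indices. -/
structure HasConnectionCoeffs [CompleteSpace V] (e : ι → ∀ x : M, TangentSpace I x)
    (Γ : ι → ι → ι → ℝ) : Prop where
  antisymm : ∀ i j k, Γ i j k = -Γ i k j
  mlieBracket_eq : ∀ i j (x : M),
    VectorField.mlieBracket I (e i) (e j) x = ∑ k, (Γ i j k - Γ j i k) • e k x

/-- Torsion is tensorial, so it is enough to test it on the frame, where the derivative terms vanish
and the bracket cancels the differences of `Γ`. Metricity is the product rule for `g(σ, τ) = ∑ k,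
σ_k τ_k`; the terms in `Γ` cancel by antisymmetry. -/
theorem isLeviCivita_connection [CompleteSpace V] (h : IsOrthonormalFrame g e)
    {Γ : ι → ι → ι → ℝ} (hΓ : HasConnectionCoeffs (I := I) e Γ) :
    IsLeviCivita g (h.connection Γ) := by
  refine ⟨?_, fun σ τ x X hσ hτ => ?_⟩
  · ext1 x
    refine ContinuousLinearMap.coe_injective ((h.basis x).ext fun i => ?_)
    refine ContinuousLinearMap.coe_injective ((h.basis x).ext fun j => ?_)
    simp only [basis_apply, ContinuousLinearMap.coe_coe]
    rw [CovariantDerivative.torsion_apply _ (h.mdifferentiable i x) (h.mdifferentiable j x)]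
    refine h.ext_inner fun k => ?_
    simp only [map_sub, sub_apply, h.inner_connection, h.mvfderiv_inner_frame, hΓ.mlieBracket_eq]
    simp [h.inner_eq]
  · have hs k := g.mdifferentiableAt_inner hσ (h.mdifferentiable k x)
    have ht k := g.mdifferentiableAt_inner hτ (h.mdifferentiable k x)
    have h1 : (fun y => g.inner y (σ y) (τ y)) = ∑ k,
        (fun y => g.inner y (σ y) (e k y)) * fun y => g.inner y (τ y) (e k y) := by
      ext y
      simpa using h.inner_eq_sum y (σ y) (τ y)
    have hskew (a b : ι → ℝ) (i : ι) :
        ∑ k, ∑ j, Γ i j k * a j * b k + ∑ k, ∑ j, Γ i j k * b j * a k = 0 := by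
      rw [Finset.sum_comm, ← Finset.sum_add_distrib]
      refine Finset.sum_eq_zero fun j _ => ?_
      rw [← Finset.sum_add_distrib]
      refine Finset.sum_eq_zero fun k _ => ?_
      rw [hΓ.antisymm i j k]
      ring
    -- The components `c` of the direction are pulled out, so that `hskew` applies for each fixed
    -- `i`.
    have hpull (a c b : ι → ℝ) : ∑ k, (∑ i, ∑ j, Γ i j k * a j * c i) * b k =
        ∑ i, c i * ∑ k, ∑ j, Γ i j k * a j * b k := by
      simp only [Finset.sum_mul, Finset.mul_sum]
      rw [Finset.sum_comm]
      exact Finset.sum_congr rfl fun k _ => Finset.sum_congr rfl fun j _ =>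
        Finset.sum_congr rfl fun i _ => by ring
    have hskew' : ∑ k, (∑ i, ∑ j, Γ i j k * g.inner x (σ x) (e j x) * g.inner x X (e i x)) *
        g.inner x (τ x) (e k x) + ∑ k, (∑ i, ∑ j, Γ i j k * g.inner x (τ x) (e j x) *
        g.inner x X (e i x)) * g.inner x (σ x) (e k x) = 0 := by
      rw [hpull, hpull _ _ fun k => g.inner x (σ x) (e k x), ← Finset.sum_add_distrib]
      exact Finset.sum_eq_zero fun i _ => by rw [← mul_add, hskew, mul_zero]
    rw [g.symm x (σ x), h.inner_eq_sum x (h.connection Γ σ x X),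
      h.inner_eq_sum x (h.connection Γ τ x X), h1, 
      (mdifferentiableAt_sum_and_mvfderiv_sum _ fun k _ => (hs k).mul (ht k)).2]
    simp only [mvfderiv_mul (hs _) (ht _), h.inner_connection, sum_apply, add_apply, smul_apply,
      add_mul, Finset.sum_add_distrib, smul_eq_mul]
    rw [add_add_add_comm, hskew', add_zero, add_comm]
    congr 1 <;> exact Finset.sum_congr rfl fun k _ => by ring

/-- Koszul's formula in a frame with constant structure functions. -/
theorem inner_of_isLeviCivita [CompleteSpace V] (h : IsOrthonormalFrame g e)
    {Γ : ι → ι → ι → ℝ} (hΓ : HasConnectionCoeffs (I := I) e Γ)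
    {nabla : CovariantDerivative I V (fun x : M => TangentSpace I x)}
    (hn : IsLeviCivita g nabla) (x : M) (i j k : ι) :
    g.inner x (nabla (e j) x (e i x)) (e k x) = Γ i j k := by
  have htors i j k : g.inner x (nabla (e j) x (e i x)) (e k x) -
      g.inner x (nabla (e i) x (e j x)) (e k x) = Γ i j k - Γ j i k := by
    have h1 := CovariantDerivative.torsion_apply nabla (h.mdifferentiable i x)
      (h.mdifferentiable j x)
    have h2 : nabla.torsion = 0 := hn.1
    rw [h2, hΓ.mlieBracket_eq] at h1
    have h3 := congrArg (fun X => g.inner x X (e k x)) h1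
    simp [h.inner_eq] at h3
    linarith
  have hmet i j k : g.inner x (nabla (e j) x (e i x)) (e k x) +
      g.inner x (nabla (e k) x (e i x)) (e j x) = 0 := by
    have h1 := hn.2 (e j) (e k) x (e i x) (h.mdifferentiable j x) (h.mdifferentiable k x)
    rw [h.mvfderiv_inner_frame] at h1
    rw [g.symm x (nabla (e k) x (e i x))]
    simpa using h1.symm
  -- The difference between the actual coefficients and `Γ` is symmetric in its first two indices
  -- and antisymmetric in its last two. Alternating the two symmetries around the three indices
  -- shows that it equals its own negative.
  linarith [htors i j k, htors k i j, htors j k i, hmet i j k, hmet j k i, hmet k i j,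
    hΓ.antisymm i j k, hΓ.antisymm j k i, hΓ.antisymm k i j]

end IsOrthonormalFrame
end OrthonormalFrame

/-! ## Generalised Killing spinors that are constant in an orthonormal frame -/

section KillingFrame

variable {V : Type*} [NormedAddCommGroup V] [NormedSpace ℝ V]
  {H : Type*} [TopologicalSpace H]
  {I : ModelWithCorners ℝ V H} {M : Type*} [TopologicalSpace M] [ChartedSpace H M]
  [IsManifold I ∞ M] {ι : Type*} [Fintype ι] [DecidableEq ι]
  {S : Type*} [NormedAddCommGroup S] [NormedSpace ℂ S]
  {g : RiemMetric I M} {e : ι → ∀ x : M, TangentSpace I x} {γ : ι → S →ₗ[ℂ] S} {s : S}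

/-- The endomorphism field with `e_i ↦ κ i e_i`. -/
def diagEndo (g : RiemMetric I M) (e : ι → ∀ x : M, TangentSpace I x) (κ : ι → ℝ) (x : M) :
    TangentSpace I x →L[ℝ] TangentSpace I x :=
  ∑ i, (κ i • g.inner x (e i x)).smulRight (e i x)

namespace IsOrthonormalFrame

theorem cliffordMul_frame (h : IsOrthonormalFrame g e) (x : M) (r : ℝ) (i : ι) :
    cliffordMul g e γ x (r • e i x) s = (r : ℂ) • γ i s := by
  simp [cliffordMul, h.inner_eq]

theorem inner_diagEndo (h : IsOrthonormalFrame g e) (κ : ι → ℝ) (x : M) (X : TangentSpace I x)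
    (i : ι) : g.inner x (diagEndo g e κ x X) (e i x) = κ i * g.inner x X (e i x) := by
  simp [diagEndo, h.inner_eq, g.symm x X]

variable [FiniteDimensional ℝ V]

theorem diagEndo_symm (h : IsOrthonormalFrame g e) (κ : ι → ℝ) (x : M) (X Y : TangentSpace I x) :
    g.inner x (diagEndo g e κ x X) Y = g.inner x X (diagEndo g e κ x Y) := by
  rw [h.inner_eq_sum, h.inner_eq_sum x X]
  simp only [h.inner_diagEndo]
  exact Finset.sum_congr rfl fun i _ => by ring

/-- The derivative of a constant map vanishes, and what remains is linear in `X`, so it is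
determined by its values on the frame. -/
theorem spinConnection_const [CompleteSpace V] (h : IsOrthonormalFrame g e) {Γ : ι → ι → ι → ℝ}
    (hΓ : HasConnectionCoeffs (I := I) e Γ)
    {nabla : CovariantDerivative I V (fun x : M => TangentSpace I x)}
    (hn : IsLeviCivita g nabla) (x : M) (X : TangentSpace I x) :
    spinConnection g nabla e γ (fun _ => s) x X =
      ∑ i, (g.inner x X (e i x) : ℂ) • spinLift γ (Γ i) s := by
  have hX j k : g.inner x (nabla (e j) x X) (e k x) = ∑ i, g.inner x X (e i x) * Γ i j k := by
    conv_lhs => rw [← h.sum_inner_smul x X]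
    simp [h.inner_of_isLeviCivita hΓ hn]
  simp only [spinConnection, spinLift, hX, mvfderiv_const, zero_apply, zero_add]
  simp only [Complex.ofReal_sum, Complex.ofReal_mul, Finset.sum_smul, Finset.smul_sum]
  have hc (f : ι → ι → ι → S) : ∑ j, ∑ k, ∑ i, f i j k = ∑ i, ∑ j, ∑ k, f i j k := by
    rw [Finset.sum_comm (f := fun i j => ∑ k, f i j k)]
    exact Finset.sum_congr rfl fun j _ => Finset.sum_comm
  rw [hc]
  refine Finset.sum_congr rfl fun i _ => Finset.sum_congr rfl fun j _ =>
    Finset.sum_congr rfl fun k _ => ?_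
  module

theorem isGenKillingWith_diagEndo [CompleteSpace V] (h : IsOrthonormalFrame g e)
    {Γ : ι → ι → ι → ℝ} (hΓ : HasConnectionCoeffs (I := I) e Γ)
    {nabla : CovariantDerivative I V (fun x : M => TangentSpace I x)} (hn : IsLeviCivita g nabla)
    {κ : ι → ℝ} (hκ : ∀ i, spinLift γ (Γ i) s = (κ i : ℂ) • γ i s)
    (hsmooth : ContMDiff I (I.prod 𝓘(ℝ, V →L[ℝ] V)) ∞
      (fun x => Bundle.TotalSpace.mk' (V →L[ℝ] V)
        (E := fun x : M => TangentSpace I x →L[ℝ] TangentSpace I x) x (diagEndo g e κ x))) :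
    IsGenKillingWith g nabla e γ (fun _ => s) (diagEndo g e κ) where
  smooth_spinor := contMDiff_const
  smooth_endo := hsmooth
  symm := h.diagEndo_symm κ
  eq x X := by
    rw [h.spinConnection_const hΓ hn]
    simp only [cliffordMul, hκ, h.inner_diagEndo, smul_smul, Complex.ofReal_mul, mul_comm]

/-- By `hγ` a real tangent vector is determined by its Clifford product with `s`, so the Killing
equation forces `A e_i = κ i e_i`. An eigenvector has a nonzero component along some `e_i`, and the
symmetry of `A` then identifies its eigenvalue with `κ i`. -/
theorem eigenvaluesAt_eq_range [CompleteSpace V] (h : IsOrthonormalFrame g e)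
    {Γ : ι → ι → ι → ℝ} (hΓ : HasConnectionCoeffs (I := I) e Γ)
    {nabla : CovariantDerivative I V (fun x : M => TangentSpace I x)} (hn : IsLeviCivita g nabla)
    {κ : ι → ℝ} (hκ : ∀ i, spinLift γ (Γ i) s = (κ i : ℂ) • γ i s)
    (hγ : ∀ r : ι → ℝ, ∑ i, (r i : ℂ) • γ i s = 0 → r = 0)
    {A : ∀ x : M, TangentSpace I x →L[ℝ] TangentSpace I x}
    (hA : IsGenKillingWith g nabla e γ (fun _ => s) A) (x : M) :
    eigenvaluesAt A x = Set.range κ := by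
  have hAe i : A x (e i x) = κ i • e i x := by
    have h1 := hA.eq x (e i x)
    rw [h.spinConnection_const hΓ hn] at h1
    have h2 : ∑ j, (g.inner x (e i x) (e j x) : ℂ) • spinLift γ (Γ j) s = (κ i : ℂ) • γ i s := by
      simp [h.inner_eq, hκ]
    rw [h2, ← h.cliffordMul_frame x, ← sub_eq_zero, cliffordMul, cliffordMul,
      ← Finset.sum_sub_distrib] at h1
    have h3 := hγ (fun j => g.inner x (κ i • e i x) (e j x) - g.inner x (A x (e i x)) (e j x))
      (by simpa only [Complex.ofReal_sub, sub_smul] using h1)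
    exact h.ext_inner fun j => by have := congrFun h3 j; simp only [Pi.zero_apply] at this; linarith
  ext r
  constructor
  · intro hr
    obtain ⟨X, hX⟩ := Module.End.HasEigenvalue.exists_hasEigenvector hr
    have hAX : A x X = r • X := hX.apply_eq_smul
    obtain ⟨i, hi⟩ : ∃ i, g.inner x X (e i x) ≠ 0 := by
      by_contra! H
      exact hX.2 (h.ext_inner fun i => by simp [H])
    refine ⟨i, mul_right_cancel₀ hi ?_⟩
    have := hA.symm x X (e i x)
    rw [hAX, hAe] at this
    simpa using this.symm
  · rintro ⟨i, rfl⟩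
    refine Module.End.hasEigenvalue_of_hasEigenvector (x := e i x)
      ⟨Module.End.mem_eigenspace_iff.2 (hAe i), fun h0 => ?_⟩
    have := h.inner_eq x i i
    simp [h0] at this

end IsOrthonormalFrame
end KillingFrame

/-! ## Sections of tensor bundles over a vector space -/

section VectorSpace

variable {E : Type*} [NormedAddCommGroup E] [NormedSpace ℝ E] {k : WithTop ℕ∞}

theorem trivializationAt_dual_apply (x y : E) (f : TangentSpace 𝓘(ℝ, E) y →L[ℝ] ℝ) (v : E) :
    ((trivializationAt (E →L[ℝ] ℝ)
      (fun x : E => TangentSpace 𝓘(ℝ, E) x →L[ℝ] Bundle.Trivial E ℝ x) x) ⟨y, f⟩).2 v = f v := by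
  rw [hom_trivializationAt_apply]
  simp only [ContinuousLinearMap.inCoordinates, ContinuousLinearMap.comp_apply,
    Bundle.Trivialization.continuousLinearMapAt_apply]
  simp
  rfl

/-- Bilinear forms are a Hom bundle with values in a Hom bundle: the outer layer is unfolded here,
the inner one by `trivializationAt_dual_apply`. -/
theorem trivializationAt_bilin_apply (x y : E)
    (f : TangentSpace 𝓘(ℝ, E) y →L[ℝ] TangentSpace 𝓘(ℝ, E) y →L[ℝ] ℝ) (v w : E) :
    ((trivializationAt (E →L[ℝ] E →L[ℝ] ℝ) (fun x : E => TangentSpace 𝓘(ℝ, E) x →L[ℝ]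
      TangentSpace 𝓘(ℝ, E) x →L[ℝ] Bundle.Trivial E ℝ x) x) ⟨y, f⟩).2 v w = f v w := by
  rw [hom_trivializationAt_apply]
  simp only [ContinuousLinearMap.inCoordinates, ContinuousLinearMap.comp_apply,
    Bundle.Trivialization.continuousLinearMapAt_apply]
  have := TangentBundle.symmL_model_space (𝕜 := ℝ) (F := E) x y
  rw [this, Bundle.Trivialization.coe_linearMapAt_of_mem]
  · exact trivializationAt_dual_apply x y (f v) w
  · simp
    exact Set.mem_univ y

/-- The tangent trivialisations of a vector space are identities, so smoothness of a section is
ordinary smoothness of a map into a fixed space. -/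
theorem contMDiff_endo_section_iff
    {f : ∀ x : E, TangentSpace 𝓘(ℝ, E) x →L[ℝ] TangentSpace 𝓘(ℝ, E) x} :
    ContMDiff 𝓘(ℝ, E) (𝓘(ℝ, E).prod 𝓘(ℝ, E →L[ℝ] E)) k
      (fun x => Bundle.TotalSpace.mk' (E →L[ℝ] E)
        (E := fun x : E => TangentSpace 𝓘(ℝ, E) x →L[ℝ] TangentSpace 𝓘(ℝ, E) x) x (f x)) ↔
    ContDiff (E := E) (F := E →L[ℝ] E) ℝ k f := by
  refine Iff.trans ?_ contMDiff_iff_contDiff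
  refine forall_congr' fun x => (Bundle.contMDiffAt_section _).trans ?_
  refine iff_of_eq (congrArg (fun F => ContMDiffAt 𝓘(ℝ, E) 𝓘(ℝ, E →L[ℝ] E) k F x) ?_)
  ext1 y
  rw [hom_trivializationAt_apply]
  exact inCoordinates_tangent_bundle_core_model_space (I := 𝓘(ℝ, E)) (I' := 𝓘(ℝ, E)) x y x y (f y)

theorem contMDiff_bilin_section_iff
    {f : ∀ x : E, TangentSpace 𝓘(ℝ, E) x →L[ℝ] TangentSpace 𝓘(ℝ, E) x →L[ℝ] ℝ} :
    ContMDiff 𝓘(ℝ, E) (𝓘(ℝ, E).prod 𝓘(ℝ, E →L[ℝ] E →L[ℝ] ℝ)) k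
      (fun x => Bundle.TotalSpace.mk' (E →L[ℝ] E →L[ℝ] ℝ)
        (E := fun x : E => TangentSpace 𝓘(ℝ, E) x →L[ℝ] TangentSpace 𝓘(ℝ, E) x →L[ℝ] ℝ) x (f x)) ↔
    ContDiff (E := E) (F := E →L[ℝ] E →L[ℝ] ℝ) ℝ k f := by
  refine Iff.trans ?_ contMDiff_iff_contDiff
  refine forall_congr' fun x => (Bundle.contMDiffAt_section _).trans ?_
  refine iff_of_eq (congrArg (fun F => ContMDiffAt 𝓘(ℝ, E) 𝓘(ℝ, E →L[ℝ] E →L[ℝ] ℝ) k F x) ?_)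
  ext y v w
  exact trivializationAt_bilin_apply x y (f y) v w

end VectorSpace

/-! ## Left-invariant frames of the Heisenberg group -/

section Heis

variable {n : ℕ}

/-- The differential at `1` of the left translation by `x`. -/
def heisTranslate (x : HeisModel n) : HeisModel n →L[ℝ] HeisModel n :=
  ContinuousLinearMap.id ℝ _ + ((∑ i, x.1 i • (ContinuousLinearMap.proj i : (Fin n → ℝ) →L[ℝ] ℝ)).comp
    ((ContinuousLinearMap.fst ℝ _ _).comp (ContinuousLinearMap.snd ℝ _ _))).smulRight
      ((0, 0, 1) : HeisModel n)

theorem heisTranslate_apply (x X : HeisModel n) :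
    heisTranslate x X = (X.1, X.2.1, X.2.2 + x.1 ⬝ᵥ X.2.1) := by
  simp [heisTranslate, Prod.ext_iff, dotProduct]

theorem contDiff_heisTranslate : ContDiff ℝ ∞ (heisTranslate (n := n)) := by
  unfold heisTranslate
  fun_prop

/-- In the chart, left translation is the affine map `z ↦ x + heisTranslate x z`, so its
differential is the same at every `y`. -/
theorem hasMFDerivAt_mul_left (x y : Heisenberg n) :
    HasMFDerivAt 𝓘(ℝ, HeisModel n) 𝓘(ℝ, HeisModel n) (x * ·) y (heisTranslate x) := by
  have h (x y : HeisModel n) : HasFDerivAt (fun z : HeisModel n =>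
      ((x.1 + z.1, x.2.1 + z.2.1, x.2.2 + z.2.2 + x.1 ⬝ᵥ z.2.1) : HeisModel n))
      (heisTranslate x) y := by
    convert! (heisTranslate x).hasFDerivAt.const_add x using 2 with z
    rw [heisTranslate_apply]
    simp [Prod.ext_iff, add_assoc]
  exact (h x y).hasMFDerivAt

theorem mulInvariantVectorField_heis (u : HeisAlg n) (x : Heisenberg n) :
    mulInvariantVectorField u x = heisTranslate x u := by
  rw [mulInvariantVectorField, (hasMFDerivAt_mul_left x 1).mfderiv]
  rfl

theorem contDiff_leftInvFrame (u : HeisIndex n → HeisAlg n) (i : HeisIndex n) :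
    ContDiff ℝ ∞ (fun x : HeisModel n => (leftInvFrame u i x : HeisModel n)) := by
  have : (fun x : HeisModel n => (leftInvFrame u i x : HeisModel n)) = fun x => heisTranslate x (u i) :=
    funext fun x => mulInvariantVectorField_heis (u i) x
  rw [this]
  exact contDiff_heisTranslate.clm_apply contDiff_const

theorem contMDiff_diagEndo_leftInvFrame (g : RiemMetric 𝓘(ℝ, HeisModel n) (Heisenberg n))
    (u : HeisIndex n → HeisAlg n) (κ : HeisIndex n → ℝ) :
    ContMDiff 𝓘(ℝ, HeisModel n) (𝓘(ℝ, HeisModel n).prod 𝓘(ℝ, HeisModel n →L[ℝ] HeisModel n)) ∞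
      (fun x : Heisenberg n => Bundle.TotalSpace.mk' (HeisModel n →L[ℝ] HeisModel n)
        (E := fun x : Heisenberg n => TangentSpace 𝓘(ℝ, HeisModel n) x →L[ℝ]
          TangentSpace 𝓘(ℝ, HeisModel n) x) x (diagEndo g (leftInvFrame u) κ x)) := by
  have hg := (contMDiff_bilin_section_iff (E := HeisModel n) (f := fun x => g.inner x)).1 g.contMDiff
  refine (contMDiff_endo_section_iff (E := HeisModel n)
    (f := fun x => diagEndo g (leftInvFrame u) κ x)).2 ?_
  unfold diagEndo
  refine ContDiff.sum fun i _ => ?_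
  have h := contDiff_leftInvFrame u i
  exact ((hg.clm_apply h).const_smul (κ i)).smulRight h

/-- Left-invariant metrics are determined at the identity. -/
theorem IsLeftInvariant.inner_mulInvariantVectorField
    {g : RiemMetric 𝓘(ℝ, HeisModel n) (Heisenberg n)} (hg : IsLeftInvariant g) (u v : HeisAlg n)
    (x : Heisenberg n) :
    g.inner x (mulInvariantVectorField u x) (mulInvariantVectorField v x) = g.inner 1 u v := by
  rw [← hg x 1 u v, mulInvariantVectorField_heis, mulInvariantVectorField_heis,
    (hasMFDerivAt_mul_left x 1).mfderiv]
  -- Left-invariance lands over `x * 1`, which equals `x` only propositionally; all tangent spaces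
  -- being the model space, the base point can be replaced.
  have : ∀ y : Heisenberg n, y = x → ∀ a b : HeisModel n, g.inner x a b = g.inner y a b := by
    rintro y rfl a b; rfl
  exact this _ (mul_one x) _ _

theorem card_heisIndex : Fintype.card (HeisIndex n) = Module.finrank ℝ (HeisModel n) := by
  simp; omega

theorem IsLeftInvariantWith.isOrthonormalFrame {g : RiemMetric 𝓘(ℝ, HeisModel n) (Heisenberg n)}
    {u : HeisIndex n → HeisAlg n} (h : IsLeftInvariantWith g u) :
    IsOrthonormalFrame g (leftInvFrame u) where
  card_eq := card_heisIndex
  mdifferentiable i x := by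
    have : ContMDiff 𝓘(ℝ, HeisModel n) 𝓘(ℝ, HeisModel n).tangent ∞
      (fun y : HeisModel n => (⟨y, leftInvFrame u i y⟩ : TangentBundle 𝓘(ℝ, HeisModel n) (HeisModel n))) :=
      contMDiff_vectorSpace_iff_contDiff.2 (contDiff_leftInvFrame u i)
    exact this.mdifferentiable (by simp) x
  inner_eq x i j := by
    rw [← h.2 i j]
    exact h.1.inner_mulInvariantVectorField _ _ _

/-- The bracket of `𝔥_{2n+1}` in coordinates. -/
theorem heis_lie (u v : HeisAlg n) :
    ⁅u, v⁆ = ((0, 0, (u : HeisModel n).1 ⬝ᵥ (v : HeisModel n).2.1 -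
      (v : HeisModel n).1 ⬝ᵥ (u : HeisModel n).2.1) : HeisModel n) := by
  -- Left-invariant fields are affine in the chart, and the identity is the origin, so only their
  -- linear parts enter the bracket there.
  have hd (w : HeisModel n) : HasFDerivAt (fun x : HeisModel n => heisTranslate x w)
      (((∑ i, w.2.1 i • (ContinuousLinearMap.proj i : (Fin n → ℝ) →L[ℝ] ℝ)).comp
        (ContinuousLinearMap.fst ℝ _ _)).smulRight ((0, 0, 1) : HeisModel n)) (0 : HeisModel n) := by
    have := ((((∑ i, w.2.1 i • (ContinuousLinearMap.proj i : (Fin n → ℝ) →L[ℝ] ℝ)).comp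
        (ContinuousLinearMap.fst ℝ _ _)).smulRight ((0, 0, 1) : HeisModel n)).hasFDerivAt
        (x := (0 : HeisModel n))).const_add w
    convert! this using 2 with x
    simp [heisTranslate_apply, Prod.ext_iff, dotProduct, mul_comm]
  have hb (u v : HeisModel n) : VectorField.lieBracket ℝ (fun x : HeisModel n => heisTranslate x u)
      (fun x => heisTranslate x v) 0 = (0, 0, u.1 ⬝ᵥ v.2.1 - v.1 ⬝ᵥ u.2.1) := by
    rw [VectorField.lieBracket, (hd u).fderiv, (hd v).fderiv]
    simp [heisTranslate_apply, dotProduct, mul_comm]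
  have e1 (w : HeisAlg n) : mulInvariantVectorField (G := Heisenberg n) w =
      fun x => heisTranslate x w := funext fun x => mulInvariantVectorField_heis w x
  rw [GroupLieAlgebra.bracket_def, e1, e1]
  have e2 := VectorField.mlieBracketWithin_eq_lieBracketWithin (𝕜 := ℝ)
    (V := fun x : HeisModel n => heisTranslate x u) (W := fun x : HeisModel n => heisTranslate x v)
    (s := Set.univ)
  exact (congrFun (VectorField.mlieBracketWithin_univ.symm.trans (e2.trans
    VectorField.lieBracketWithin_univ)) (0 : HeisModel n)).trans (hb u v)

end Heis

/-! ## The connection coefficients and their action on the spinor `1` -/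

section HeisSpinor

variable {n : ℕ}

@[simp] theorem contractX_one (p : Fin n) : contractX p (1 : Spinor n) = 0 :=
  CliffordAlgebra.contractLeft_one (Q := (0 : QuadraticForm ℂ (Fin n → ℂ))) _

@[simp] theorem parity_one : parity (1 : Spinor n) = 1 :=
  map_one (CliffordAlgebra.involute (Q := (0 : QuadraticForm ℂ (Fin n → ℂ))))

theorem wedgeY_self (p : Fin n) (η : Spinor n) : wedgeY p (wedgeY p η) = 0 := by
  have h' : ∀ z : ExteriorAlgebra ℂ (Fin n → ℂ),
      ExteriorAlgebra.ι ℂ (Pi.single p 1) * (ExteriorAlgebra.ι ℂ (Pi.single p 1) * z) = 0 := by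
    intro z
    rw [← mul_assoc, ExteriorAlgebra.ι_sq_zero, zero_mul]
  exact h' η

theorem spinor_one_ne_zero : (1 : Spinor n) ≠ 0 :=
  one_ne_zero (α := ExteriorAlgebra ℂ (Fin n → ℂ))

/-- The coefficients `g(∇_{e_i} e_j, e_k)` of the Levi-Civita connection in a left-invariant
orthonormal frame with `[E_p, F_p] = 4 l_p Z`. -/
def heisCoeff (l : Fin n → ℝ) : HeisIndex n → HeisIndex n → HeisIndex n → ℝ
  | .inl _, .inr (.inl p), .inr (.inr q) => if p = q then -(2 * l p) else 0
  | .inl _, .inr (.inr p), .inr (.inl q) => if p = q then 2 * l p else 0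
  | .inr (.inl p), .inr (.inr q), .inl _ => if p = q then 2 * l p else 0
  | .inr (.inl p), .inl _, .inr (.inr q) => if p = q then -(2 * l p) else 0
  | .inr (.inr p), .inr (.inl q), .inl _ => if p = q then -(2 * l p) else 0
  | .inr (.inr p), .inl _, .inr (.inl q) => if p = q then 2 * l p else 0
  | _, _, _ => 0

/-- The eigenvalues of the spinor `1`, as a function of the frame index. -/
def heisEigenvalue (l : Fin n → ℝ) : HeisIndex n → ℝ
  | .inl _ => -∑ q, l q
  | .inr (.inl p) => l p
  | .inr (.inr p) => l p

theorem range_heisEigenvalue (l : Fin n → ℝ) :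
    Set.range (heisEigenvalue l) = Set.range l ∪ {-∑ q, l q} := by
  ext r
  simp [heisEigenvalue, eq_comm]

/-- The double sum meets each unordered pair twice; as `Γ i` is antisymmetric and distinct `e_j,
e_k` anticommute, the two contributions agree. What is left are the three products of Clifford
operators on `1` given at the outset. -/
theorem spinLift_heisCoeff (l : Fin n → ℝ) (i : HeisIndex n) :
    spinLift heisGamma (heisCoeff l i) (1 : Spinor n) =
      (heisEigenvalue l i : ℂ) • heisGamma i (1 : Spinor n) := by
  have hI (z : Spinor n) : Complex.I • Complex.I • z = -z := by
    rw [smul_smul, Complex.I_mul_I, neg_one_smul]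
  rcases i with i | p | p
  · simp [spinLift, heisCoeff, heisGamma, heisEigenvalue, contractX_wedgeY, wedgeY_self,
      Finset.sum_add_distrib]
    simp only [Finset.smul_sum, Finset.sum_smul, ← Finset.sum_add_distrib,
      ← Finset.sum_neg_distrib, ← Complex.coe_smul, Complex.ofReal_mul, Complex.ofReal_ofNat]
    refine Finset.sum_congr rfl fun q _ => ?_
    module
  · simp [spinLift, heisCoeff, heisGamma, heisEigenvalue, parity_wedgeY]
    simp only [← Complex.coe_smul, Complex.ofReal_mul, Complex.ofReal_ofNat]
    module
  · simp [spinLift, heisCoeff, heisGamma, heisEigenvalue, parity_wedgeY]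
    simp only [← Complex.coe_smul, Complex.ofReal_mul, Complex.ofReal_ofNat, hI]
    module

theorem heisGamma_one_independent (r : HeisIndex n → ℝ)
    (h : ∑ i, (r i : ℂ) • heisGamma i (1 : Spinor n) = 0) : r = 0 := by
  simp only [Fintype.sum_sum_type, heisGamma, Finset.univ_unique, Finset.sum_singleton,
    LinearMap.smul_apply, LinearMap.add_apply, LinearMap.sub_apply, contractX_one, parity_one,
    zero_add, sub_zero, smul_smul] at h
  rw [← Finset.sum_add_distrib] at h
  simp only [← add_smul] at h
  -- The vector acts on `1` as `i r_Z + ∑ (i r_E + r_F) y_q`; contracting with `x_q` isolates one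
  -- coefficient, and since `r` is real its real and imaginary parts vanish separately.
  have hq (q : Fin n) : (r (.E q) : ℂ) * Complex.I + r (.F q) = 0 := by
    have h2 := congrArg (contractX q) h
    simp [contractX_wedgeY, Finset.sum_ite_eq] at h2
    exact h2.resolve_right spinor_one_ne_zero
  have hEF (q : Fin n) : r (.E q) = 0 ∧ r (.F q) = 0 := by
    have h2 := hq q
    rw [Complex.ext_iff] at h2
    simpa [and_comm] using h2
  have hZ : r .Z = 0 := by
    simp only [hq, zero_smul, Finset.sum_const_zero, add_zero] at h
    simpa [spinor_one_ne_zero] using h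
  funext i
  rcases i with i | p | p
  exacts [hZ, (hEF p).1, (hEF p).2]

/-- For `E_p, F_p` the difference is `2 λ_p - (-2 λ_p) = 4 λ_p`, the structure constant; this
explains the factor `1/4`. For pairs involving `Z` the two coefficients are equal and cancel. -/
theorem HasHeisRelations.lie_eq {a b : Fin n → ℝ} {c : ℝ} {u : HeisIndex n → HeisAlg n}
    (h : HasHeisRelations a b c u) (i j : HeisIndex n) :
    ⁅u i, u j⁆ = ∑ k, (heisCoeff (heisLambda a b c) i j k - heisCoeff (heisLambda a b c) j i k) •
      u k := by
  have hskew (v w : HeisAlg n) : ⁅v, w⁆ = -⁅w, v⁆ := VectorField.mlieBracket_swap_apply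
  have hself (v : HeisAlg n) : ⁅v, v⁆ = 0 := congrFun VectorField.mlieBracket_self _
  rcases i with i | p | p <;> rcases j with j | q | q
  · simp [heisCoeff, hself]
  · simp [heisCoeff, hskew (u (.inl i)), h.lie_E_Z]
  · simp [heisCoeff, hskew (u (.inl i)), h.lie_F_Z]
  · simp [heisCoeff, h.lie_E_Z]
  · simp [heisCoeff, h.lie_E_E]
  · rw [h.lie_E_F]
    by_cases hpq : p = q
    · subst hpq
      simp [heisCoeff, heisLambda]
      module
    · simp [heisCoeff, hpq, Ne.symm hpq]
  · simp [heisCoeff, h.lie_F_Z]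
  · rw [hskew, h.lie_E_F]
    by_cases hpq : p = q
    · subst hpq
      simp [heisCoeff, heisLambda]
      module
    · simp [heisCoeff, hpq, Ne.symm hpq]
  · simp [heisCoeff, h.lie_F_F]

theorem HasHeisRelations.hasConnectionCoeffs {a b : Fin n → ℝ} {c : ℝ}
    {u : HeisIndex n → HeisAlg n} (h : HasHeisRelations a b c u) :
    IsOrthonormalFrame.HasConnectionCoeffs (I := 𝓘(ℝ, HeisModel n)) (leftInvFrame u)
      (heisCoeff (heisLambda a b c)) where
  antisymm i j k := by
    rcases i with i | p | p <;> rcases j with j | q | q <;> rcases k with k | r | r <;>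
      simp [heisCoeff]
    all_goals
      split_ifs <;> simp_all
  mlieBracket_eq i j x := by
    have : LieGroup 𝓘(ℝ, HeisModel n) (minSmoothness ℝ 3) (Heisenberg n) :=
      LieGroup.of_le (n := ∞) (by
      rw [minSmoothness_of_isRCLikeNormedField]
      exact WithTop.coe_le_coe.2 (le_top : (3 : ℕ∞) ≤ ⊤))
    -- Brackets of left-invariant fields are left-invariant, so the relation at the identity is
    -- carried to `x` by linearity.
    have h1 := congrFun (mulInvariantVector_mlieBracket (u i) (u j)) x
    have h2 : VectorField.mlieBracket 𝓘(ℝ, HeisModel n) (mulInvariantVectorField (u i))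
        (mulInvariantVectorField (u j)) (1 : Heisenberg n) = ⁅u i, u j⁆ := rfl
    refine h1.symm.trans ?_
    rw [h2, h.lie_eq]
    simp only [leftInvFrame, mulInvariantVectorField, map_sum, map_smul]
    rfl

end HeisSpinor

/-! ## Eigenvalues and existence of metrics -/

section HeisMetric

variable {n : ℕ}

theorem HasHeisRelations.isGenKillingWith_one {a b : Fin n → ℝ} {c : ℝ}
    {u : HeisIndex n → HeisAlg n} {g : RiemMetric 𝓘(ℝ, HeisModel n) (Heisenberg n)}
    {nabla : HeisConnection n} (hu : HasHeisRelations a b c u) (hg : IsLeftInvariantWith g u)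
    (hn : IsLeviCivita g nabla) :
    IsGenKillingWith g nabla (leftInvFrame u) heisGamma (invariantSpinor 1)
      (diagEndo g (leftInvFrame u) (heisEigenvalue (heisLambda a b c))) :=
  hg.isOrthonormalFrame.isGenKillingWith_diagEndo hu.hasConnectionCoeffs hn
    (spinLift_heisCoeff _) (contMDiff_diagEndo_leftInvFrame g u _)

theorem HasHeisRelations.eigenvaluesAt_eq {a b : Fin n → ℝ} {c : ℝ}
    {u : HeisIndex n → HeisAlg n} {g : RiemMetric 𝓘(ℝ, HeisModel n) (Heisenberg n)}
    {nabla : HeisConnection n} (hu : HasHeisRelations a b c u) (hg : IsLeftInvariantWith g u)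
    (hn : IsLeviCivita g nabla) {A : HeisEndo n}
    (hA : IsGenKillingWith g nabla (leftInvFrame u) heisGamma (invariantSpinor 1) A)
    (x : Heisenberg n) :
    eigenvaluesAt A x = Set.range (heisLambda a b c) ∪ {-∑ q, heisLambda a b c q} := by
  rw [← range_heisEigenvalue]
  exact hg.isOrthonormalFrame.eigenvaluesAt_eq_range hu.hasConnectionCoeffs hn
    (spinLift_heisCoeff _) heisGamma_one_independent hA x

theorem hasHeisRelations_heisBasis {a b : Fin n → ℝ} {c : ℝ} (ha : ∀ p, 0 < a p)
    (hc : 0 < c) : HasHeisRelations a b c (heisBasis a b c) where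
  lie_E_F p q := by
    rw [heis_lie]
    by_cases hpq : p = q
    · subst hpq
      have h : (√(a p))⁻¹ * (√(b p))⁻¹ = √(c / (a p * b p)) * (√c)⁻¹ := by
        have := Real.sqrt_pos.2 hc
        rw [Real.sqrt_div hc.le, Real.sqrt_mul (ha p).le]
        field_simp
      simp only [heisBasis, if_true]
      refine Prod.ext ?_ (Prod.ext ?_ ?_)
      · exact (smul_zero _).symm
      · exact (smul_zero _).symm
      · refine Eq.trans (Eq.trans ?_ h) rfl
        simp
    · rw [if_neg hpq]
      simp [heisBasis, hpq]
      rfl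
  lie_E_Z p := by rw [heis_lie]; simp [heisBasis]; rfl
  lie_F_Z p := by rw [heis_lie]; simp [heisBasis]; rfl
  lie_E_E p q := by rw [heis_lie]; simp [heisBasis]; rfl
  lie_F_F p q := by rw [heis_lie]; simp [heisBasis]; rfl

/-- `heisTranslate x` depends only on the coordinate `v`, on which the group law is addition. So the
chart vector `-x` can replace the group inverse in inverting it. -/
theorem heisTranslate_heisTranslate (x y X : HeisModel n) :
    heisTranslate x (heisTranslate y X) = heisTranslate (x + y) X := by
  simp only [heisTranslate_apply, Prod.fst_add, add_dotProduct]
  refine Prod.ext rfl (Prod.ext rfl ?_)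
  dsimp only
  ring

theorem heisTranslate_zero (X : HeisModel n) : heisTranslate 0 X = X := by
  simp [heisTranslate_apply]

/-- This supplies the boundedness condition on unit balls of a Riemannian metric: an injective
linear map on a finite-dimensional space is antilipschitz, so preimages of bounded sets are bounded.
-/
theorem isBounded_sum_sq_lt_one {E ι : Type*} [NormedAddCommGroup E] [NormedSpace ℝ E]
    [FiniteDimensional ℝ E] [Fintype ι] (θ : ι → E →L[ℝ] ℝ) (hθ : ∀ X, (∀ i, θ i X = 0) → X = 0) :
    Bornology.IsBounded {X : E | ∑ i, θ i X * θ i X < 1} := by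
  obtain ⟨K, -, hK⟩ := (ContinuousLinearMap.pi θ).toLinearMap.exists_antilipschitzWith
    (LinearMap.ker_eq_bot'.2 fun X hX => hθ X fun i => congrFun hX i)
  refine (hK.isBounded_preimage (Metric.isBounded_closedBall (x := 0) (r := 1))).subset ?_
  intro X hX
  rw [Set.mem_preimage, mem_closedBall_zero_iff, pi_norm_le_iff_of_nonneg zero_le_one]
  intro i
  have h1 : θ i X * θ i X ≤ ∑ i, θ i X * θ i X :=
    Finset.single_le_sum (f := fun i => θ i X * θ i X) (fun i _ => mul_self_nonneg _)
      (Finset.mem_univ i)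
  have h2 : ∑ i, θ i X * θ i X < 1 := hX
  exact abs_le_one_iff_mul_self_le_one.2 (h1.trans h2.le)

/-- The left-invariant metric given at the identity by the sum of the squares of the linear forms
`l i`. -/
def heisMetric {ι : Type*} [Fintype ι] (l : ι → HeisModel n →L[ℝ] ℝ)
    (hl : ∀ X, (∀ i, l i X = 0) → X = 0) : RiemMetric 𝓘(ℝ, HeisModel n) (Heisenberg n) :=
  let θ (x : HeisModel n) (i : ι) : HeisModel n →L[ℝ] ℝ := (l i).comp (heisTranslate (-x))
  have hθ (x X : HeisModel n) (h : ∀ i, θ x i X = 0) : X = 0 := by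
    have h1 : heisTranslate (-x) X = 0 := hl _ h
    simpa [h1, heisTranslate_zero] using (heisTranslate_heisTranslate x (-x) X).symm
  { inner := fun x => (∑ i, (θ x i).smulRight (θ x i) : HeisModel n →L[ℝ] HeisModel n →L[ℝ] ℝ)
    symm := fun x (X Y : HeisModel n) => by
      change (∑ i, (θ x i).smulRight (θ x i) : HeisModel n →L[ℝ] HeisModel n →L[ℝ] ℝ) X Y =
        (∑ i, (θ x i).smulRight (θ x i) : HeisModel n →L[ℝ] HeisModel n →L[ℝ] ℝ) Y X
      simp [mul_comm]
    pos := fun x (X : HeisModel n) hX => by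
      change 0 < (∑ i, (θ x i).smulRight (θ x i) : HeisModel n →L[ℝ] HeisModel n →L[ℝ] ℝ) X X
      have h0 : 0 ≤ ∑ i, θ x i X * θ x i X := Finset.sum_nonneg fun i _ => mul_self_nonneg _
      simp only [sum_apply, ContinuousLinearMap.smulRight_apply, smul_apply, smul_eq_mul]
      refine h0.lt_of_ne fun h => hX (hθ x X fun i => ?_)
      have := (Finset.sum_eq_zero_iff_of_nonneg fun i _ => mul_self_nonneg _).1 h.symm i
        (Finset.mem_univ i)
      exact mul_self_eq_zero.1 this
    isVonNBounded := fun x => by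
      have h (x : HeisModel n) : Bornology.IsVonNBounded ℝ {X : HeisModel n |
          (∑ i, (θ x i).smulRight (θ x i) : HeisModel n →L[ℝ] HeisModel n →L[ℝ] ℝ) X X < 1} := by
        simpa using (NormedSpace.isVonNBounded_iff ℝ).2 (isBounded_sum_sq_lt_one (θ x) (hθ x))
      exact h x
    contMDiff := by
      refine (contMDiff_bilin_section_iff (E := HeisModel n) (f := fun x =>
        (∑ i, (θ x i).smulRight (θ x i) : HeisModel n →L[ℝ] HeisModel n →L[ℝ] ℝ))).2 ?_
      have h i : ContDiff ℝ ∞ (fun x => θ x i) :=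
        contDiff_const.clm_comp (contDiff_heisTranslate.comp contDiff_neg)
      exact ContDiff.sum fun i _ => (h i).smulRight (h i) }

theorem heisMetric_inner {ι : Type*} [Fintype ι] (l : ι → HeisModel n →L[ℝ] ℝ)
    (hl : ∀ X, (∀ i, l i X = 0) → X = 0) (x X Y : HeisModel n) :
    (heisMetric l hl).inner x X Y =
      ∑ i, l i (heisTranslate (-x) X) * l i (heisTranslate (-x) Y) := by
  change (∑ i, ((l i).comp (heisTranslate (-x))).smulRight ((l i).comp (heisTranslate (-x))) :
    HeisModel n →L[ℝ] HeisModel n →L[ℝ] ℝ) X Y = _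
  simp

theorem isLeftInvariant_heisMetric {ι : Type*} [Fintype ι] (l : ι → HeisModel n →L[ℝ] ℝ)
    (hl : ∀ X, (∀ i, l i X = 0) → X = 0) : IsLeftInvariant (heisMetric l hl) := by
  intro x y X Y
  rw [(hasMFDerivAt_mul_left x y).mfderiv]
  -- Pulling back from `x * y` and then pushing forward by `x` only sees `v`, where `-(x + y) + x =
  -- -y`.
  have h (x y X : HeisModel n) (z : Heisenberg n) (hz : z.v = x.1 + y.1) :
      heisTranslate (-(show HeisModel n from z)) (heisTranslate x X) = heisTranslate (-y) X := by
    rw [heisTranslate_heisTranslate, heisTranslate_apply, heisTranslate_apply]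
    have : (-(show HeisModel n from z) + x).1 = (-y).1 := by
      change -z.v + x.1 = -y.1
      rw [hz]; abel
    rw [this]
  refine (heisMetric_inner l hl _ _ _).trans ((heisMetric_inner l hl _ _ _).trans ?_).symm
  exact Finset.sum_congr rfl fun i _ => congrArg₂ (fun X Y => l i X * l i Y)
    (h x y X (x * y) rfl).symm (h x y Y (x * y) rfl).symm

/-- The basis dual to `heisBasis a b c`. -/
def heisDual (a b : Fin n → ℝ) (c : ℝ) : HeisIndex n → HeisModel n →L[ℝ] ℝ
  | .inl _ => √c • (ContinuousLinearMap.snd ℝ _ _).comp (ContinuousLinearMap.snd ℝ _ _)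
  | .inr (.inl p) => √(a p) • (ContinuousLinearMap.proj p).comp (ContinuousLinearMap.fst ℝ _ _)
  | .inr (.inr p) => √(b p) • (ContinuousLinearMap.proj p).comp
      ((ContinuousLinearMap.fst ℝ _ _).comp (ContinuousLinearMap.snd ℝ _ _))

theorem exists_isLeftInvariantWith_heisBasis {a b : Fin n → ℝ} {c : ℝ} (ha : ∀ p, 0 < a p)
    (hb : ∀ p, 0 < b p) (hc : 0 < c) :
    ∃ g : RiemMetric 𝓘(ℝ, HeisModel n) (Heisenberg n),
      IsLeftInvariantWith g (heisBasis a b c) := by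
  have hl (X : HeisModel n) (h : ∀ i, heisDual a b c i X = 0) : X = 0 := by
    refine Prod.ext (funext fun p => ?_) (Prod.ext (funext fun p => ?_) ?_)
    · simpa [heisDual, (Real.sqrt_pos.2 (ha p)).ne'] using h (.E p)
    · simpa [heisDual, (Real.sqrt_pos.2 (hb p)).ne'] using h (.F p)
    · simpa [heisDual, (Real.sqrt_pos.2 hc).ne'] using h .Z
  have hdual (i j : HeisIndex n) :
      heisDual a b c i (heisTranslate (-(0 : HeisModel n)) (heisBasis a b c j)) =
        if i = j then 1 else 0 := by
    rw [neg_zero]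
    erw [heisTranslate_zero]
    rcases i with i | p | p <;> rcases j with j | q | q <;>
      simp [heisDual, heisBasis, Pi.single_apply]
    · exact mul_inv_cancel₀ (Real.sqrt_pos.2 hc).ne'
    · refine if_ctx_congr Iff.rfl (fun h => ?_) fun _ => rfl
      rw [h, mul_inv_cancel₀ (Real.sqrt_pos.2 (ha _)).ne']
    · refine if_ctx_congr Iff.rfl (fun h => ?_) fun _ => rfl
      rw [h, mul_inv_cancel₀ (Real.sqrt_pos.2 (hb _)).ne']
  refine ⟨heisMetric (heisDual a b c) hl, isLeftInvariant_heisMetric _ hl, fun i j => ?_⟩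
  refine (heisMetric_inner _ hl (0 : HeisModel n) _ _).trans ?_
  simp only [hdual]
  simp [eq_comm]

/-- Indices start at `0`, so `λ_p = 1 / (4 (p + 1))`: injective and positive. The last eigenvalue is
at most `0`, hence new; this covers `n = 0` too, where it is `0` and stands alone. -/
theorem ncard_eigenvalues_sq {a b : Fin n → ℝ} (ha : ∀ p, a p = ((p : ℝ) + 1) ^ 2)
    (hb : ∀ p, b p = 1) :
    (Set.range (heisLambda a b 1) ∪ {-∑ q, heisLambda a b 1 q}).ncard = n + 1 := by
  have hl p : heisLambda a b 1 p = 1 / 4 * ((p : ℝ) + 1)⁻¹ := by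
    rw [heisLambda, ha, hb, mul_one, one_div (_ ^ 2), Real.sqrt_inv,
      Real.sqrt_sq (by positivity)]
  have hpos p : 0 < heisLambda a b 1 p := by rw [hl]; positivity
  have hinj : Function.Injective (heisLambda a b 1) := by
    intro p q h
    rw [hl, hl] at h
    have h1 : ((p : ℝ) + 1)⁻¹ = ((q : ℝ) + 1)⁻¹ := by linarith
    have h2 := inv_injective h1
    exact Fin.ext (by exact_mod_cast add_right_cancel h2)
  rw [Set.union_singleton, Set.ncard_insert_of_notMem, ← Set.image_univ,
    Set.ncard_image_of_injective _ hinj, Set.ncard_univ, Nat.card_fin]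
  rintro ⟨p, hp⟩
  have h1 := Finset.sum_nonneg fun q (_ : q ∈ Finset.univ) => (hpos q).le
  have h2 := hpos p
  rw [hp] at h2
  linarith

end HeisMetric

end

theorem theorem3p3 :
    -- `Ẑ/√c`, `Ê_p/√a_p`, `F̂_p/√b_p` is orthonormal for some left-invariant metric
    (∀ (n : ℕ) (a b : Fin n → ℝ) (c : ℝ), (∀ p, 0 < a p) → (∀ p, 0 < b p) → 0 < c →
      HasHeisRelations a b c (heisBasis a b c) ∧
      ∃ g : RiemMetric 𝓘(ℝ, HeisModel n) (Heisenberg n),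
        IsLeftInvariantWith g (heisBasis a b c)) ∧
    -- the spinor `1` is generalised Killing, with eigenvalues `λ_p` and `μ = -∑ λ_q`
    (∀ (n : ℕ) (a b : Fin n → ℝ) (c : ℝ), (∀ p, 0 < a p) → (∀ p, 0 < b p) → 0 < c →
      ∀ (u : HeisIndex n → HeisAlg n) (g : RiemMetric 𝓘(ℝ, HeisModel n) (Heisenberg n)),
        HasHeisRelations a b c u → IsLeftInvariantWith g u →
        (∃ nabla : HeisConnection n, IsLeviCivita g nabla) ∧
        ∀ nabla : HeisConnection n, IsLeviCivita g nabla →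
          IsGenKilling g nabla (leftInvFrame u) heisGamma (invariantSpinor 1) ∧
          ∀ A : HeisEndo n,
            IsGenKillingWith g nabla (leftInvFrame u) heisGamma (invariantSpinor 1) A →
            ∀ x, eigenvaluesAt A x =
              Set.range (heisLambda a b c) ∪ {-∑ q, heisLambda a b c q}) ∧
    -- for `b_p = c = 1`, `a_p = p²` (`p = 1, …, n`) there are `n + 1` distinct eigenvalues
    (∀ (n : ℕ) (a b : Fin n → ℝ), (∀ p, a p = ((p : ℝ) + 1) ^ 2) → (∀ p, b p = 1) →
      ∀ (g : RiemMetric 𝓘(ℝ, HeisModel n) (Heisenberg n)) (nabla : HeisConnection n),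
        IsLeftInvariantWith g (heisBasis a b 1) → IsLeviCivita g nabla →
        ∀ A : HeisEndo n,
          IsGenKillingWith g nabla (leftInvFrame (heisBasis a b 1)) heisGamma
            (invariantSpinor 1) A →
          ∀ x, (eigenvaluesAt A x).ncard = n + 1) ∧
    -- generalised Killing spinors exist with any number of distinct eigenvalues
    (∀ r : ℕ, 1 ≤ r → ∃ (n : ℕ) (u : HeisIndex n → HeisAlg n)
      (g : RiemMetric 𝓘(ℝ, HeisModel n) (Heisenberg n)) (nabla : HeisConnection n)
      (s : Spinor n) (A : HeisEndo n),
        IsLeftInvariantWith g u ∧ IsLeviCivita g nabla ∧ s ≠ 0 ∧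
        IsGenKillingWith g nabla (leftInvFrame u) heisGamma (invariantSpinor s) A ∧
        ∀ x, (eigenvaluesAt A x).ncard = r) := by
  refine ⟨fun n a b c ha hb hc => ⟨hasHeisRelations_heisBasis ha hc,
      exists_isLeftInvariantWith_heisBasis ha hb hc⟩,
    fun n a b c ha hb hc u g hu hg => ?_, fun n a b ha hb g nabla hg hn A hA x => ?_,
    fun r hr => ?_⟩
  · exact ⟨⟨_, hg.isOrthonormalFrame.isLeviCivita_connection hu.hasConnectionCoeffs⟩,
      fun nabla hn => ⟨⟨_, hu.isGenKillingWith_one hg hn⟩,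
        fun A hA x => hu.eigenvaluesAt_eq hg hn hA x⟩⟩
  · have hu := hasHeisRelations_heisBasis (a := a) (b := b) (c := 1)
      (fun p => by rw [ha]; positivity) one_pos
    rw [hu.eigenvaluesAt_eq hg hn hA x]
    exact ncard_eigenvalues_sq ha hb
  -- The case `r = 1` uses `n = 0`, where the group is the line and the spinor is parallel.
  · obtain ⟨n, rfl⟩ : ∃ n, r = n + 1 := ⟨r - 1, by omega⟩
    let a : Fin n → ℝ := fun p => ((p : ℝ) + 1) ^ 2
    have ha p : 0 < a p := by positivity
    have hb (p : Fin n) : 0 < (1 : Fin n → ℝ) p := one_pos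
    have hu := hasHeisRelations_heisBasis (b := 1) ha one_pos
    obtain ⟨g, hg⟩ := exists_isLeftInvariantWith_heisBasis ha hb one_pos
    have hn := hg.isOrthonormalFrame.isLeviCivita_connection hu.hasConnectionCoeffs
    have hA := hu.isGenKillingWith_one hg hn
    refine ⟨n, _, g, _, 1, _, hg, hn, spinor_one_ne_zero, hA, fun x => ?_⟩
    rw [hu.eigenvaluesAt_eq hg hn hA x]
    exact ncard_eigenvalues_sq (fun _ => rfl) (fun _ => rfl)
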